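/- **Setting.** Let $n,d\ge 1$, $V=\{1,\dots,d\}$, $p\in(1,\infty]$ and $\frac1p+\frac1q=1$. Let $F:2^V\to\mathbb R_+$ be nondecreasing and submodular, with $F(\varnothing)=0$ and $F(\{k\})>0$ for all $k\in V$. For a finite set $U$ and a set-function $G$ on $2^U$ that is positive on nonempty sets, let $\Omega_p^G$ be the norm on $\mathbb R^U$ whose dual norm is $$(\Omega_p^G)^*(s)=\max_{\varnothing\ne A\subset U}\frac{\|s_A\|_q}{G(A)^{1/q}},\qquad\text{i.e.}\qquad \Omega_p^G(w)=\max\{s^\top w: (\Omega_p^G)^*(s)\le 1\}.$$ Write $\Omega=\Omega_p^F$ and $\Omega^*=(\Omega_p^F)^*$. For $J\subset V$ let $\Omega_J$ be the norm on $\mathbb R^J$ associated with the restriction $F_J:A\mapsto F(A)$, $A\subset J$. A set $A\subset V$ is *stable* if $F(B)>F(A)$ for every $B\supsetneq A$; for $J$ stable let $\Omega^J$ be the norm on $\mathbb R^{J^c}$ associated with the contraction $F^J:A\mapsto F(A\cup J)-F(J)$, $A\subset J^c$. Let $$\rho=\min_{A\subset B,\ F(B)>F(A)}\frac{F(B)-F(A)}{F(B\setminus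 A)}\in(0,1].$$ **Proposition (Consistency).** Let $X\in\mathbb R^{n\times d}$ be fixed, $w^*\in\mathbb R^d$, $\sigma>0$, and $y=Xw^*+\sigma\varepsilon$ with $\varepsilon$ a standard normal vector in $\mathbb R^n$. Let $Q=\frac1nX^\top X$, let $J$ be the smallest stable set containing $\mathrm{Supp}(w^*)$, let $\lambda>0$, and let $\hat w$ be a minimizer over $w\in\mathbb R^d$ of $$\frac1{2n}\|y-Xw\|_2^2+\lambda\,\Omega(w).$$ Assume that for some $\kappa>0$ the $\Omega_J$-restricted eigenvalue condition holds: $$\forall\Delta\in\mathbb R^d,\qquad \Omega^J(\Delta_{J^c})\le 3\,\Omega_J(\Delta_J)\ \Longrightarrow\ \Delta^\top Q\Delta\ge\kappa\,\Omega_J(\Delta_J)^2.$$ Then, with probability at least $1-\mathbb P\big(\Omega^*(z)>\frac{\lambda\rho\sqrt n}{2\sigma}\big)$, where $z$ is a centred normal vector in $\mathbb R^d$ with covariance matrix $Q$, $$\Omega(\hat w-w^*)\le\frac{24^2\lambda}{\kappa\rho^2}\qquad\text{and}\qquad\frac1n\|X\hat w-Xw^*\|_2^2\le\frac{36\lambda^2}{\kappa\rho^2}.$$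 More precisely, there is a measurable event of at least this probability on which both bounds hold for every minimizer $\hat w$. -/

import Mathlib

open MeasureTheory ProbabilityTheory
open scoped ENNReal Matrix

noncomputable section

namespace StructuredSparsity

/-- A nondecreasing submodular set-function on the subsets of `V` that vanishes on the empty set
and is strictly positive on singletons. -/
structure IsPolymatroidFunction {V : Type*} [DecidableEq V] (F : Finset V → ℝ) : Prop where
  empty : F ∅ = 0
  mono : ∀ A B : Finset V, A ⊆ B → F A ≤ F B
  submodular : ∀ A B : Finset V, F (A ∪ B) + F (A ∩ B) ≤ F A + F B
  singleton_pos : ∀ k : V, 0 < F {k}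

/-- The exponent `q` with `1 / p + 1 / q = 1`, as a real number (`p ∈ (1, ∞]`, `q ∈ [1, ∞)`). -/
def conjExp (p : ℝ≥0∞) : ℝ := p.conjExponent.toReal

/-- The `ℓ_q`-norm `‖s_A‖_q` of the restriction of `s` to the set `A`. -/
def lqNormOn {V : Type*} (q : ℝ) (A : Finset V) (s : V → ℝ) : ℝ :=
  (∑ i ∈ A, |s i| ^ q) ^ (1 / q)

/-- `Ω_p^*(s)`, the maximum over nonempty `A ⊆ V` of `‖s_A‖_q / F(A)^{1/q}`. -/
def dualOmega {V : Type*} (p : ℝ≥0∞) (F : Finset V → ℝ) (s : V → ℝ) : ℝ :=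
  ⨆ A : {A : Finset V // A.Nonempty}, lqNormOn (conjExp p) A.1 s / F A.1 ^ (1 / conjExp p)

/-- `Ω_p(w)`: the norm whose dual norm is `Ω_p^*`, that is, the maximum of `sᵀ w` over all `s` with
`Ω_p^*(s) ≤ 1`. -/
def omega {V : Type*} [Fintype V] (p : ℝ≥0∞) (F : Finset V → ℝ) (w : V → ℝ) : ℝ :=
  ⨆ s : {s : V → ℝ // dualOmega p F s ≤ 1}, s.1 ⬝ᵥ w

/-- The restriction `F_J` of `F` to `J`, a set-function on the subsets of `J`. -/
def restriction {V : Type*} (F : Finset V → ℝ) (J : Finset V) (A : Finset {i // i ∈ J}) : ℝ :=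
  F (A.map (Function.Embedding.subtype _))

/-- The contraction `F^J : A ↦ F(A ∪ J) - F(J)`, a set-function on the subsets of the complement
of `J`. -/
def contraction {V : Type*} [DecidableEq V] (F : Finset V → ℝ) (J : Finset V)
    (A : Finset {i // i ∉ J}) : ℝ :=
  F (A.map (Function.Embedding.subtype _) ∪ J) - F J

/-- `Ω_J(w_J)`, where `Ω_J` is the norm on `ℝ^J` associated with the restriction `F_J`. -/
def omegaRestr {V : Type*} (p : ℝ≥0∞) (F : Finset V → ℝ) (J : Finset V) (w : V → ℝ) : ℝ :=
  omega p (restriction F J) (fun i => w i.1)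

/-- `Ω^J(w_{Jᶜ})`, where `Ω^J` is the norm on `ℝ^{Jᶜ}` associated with the contraction `F^J`. -/
def omegaContr {V : Type*} [Fintype V] [DecidableEq V] (p : ℝ≥0∞) (F : Finset V → ℝ)
    (J : Finset V) (w : V → ℝ) : ℝ :=
  omega p (contraction F J) (fun i => w i.1)

/-- A set is stable if every strictly larger set has a strictly larger value. -/
def IsStable {V : Type*} (F : Finset V → ℝ) (A : Finset V) : Prop :=
  ∀ B : Finset V, A ⊂ B → F A < F B

/-- The set of indices of the nonzero coordinates of `w`. -/
def supp {V : Type*} [Fintype V] (w : V → ℝ) : Finset V :=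
  {i | w i ≠ 0}

/-- `ρ`, the minimum of `(F(B) - F(A)) / F(B \ A)` over all `A ⊆ B` with `F(B) > F(A)`. -/
def rho {V : Type*} [DecidableEq V] (F : Finset V → ℝ) : ℝ :=
  ⨅ S : {S : Finset V × Finset V // S.1 ⊆ S.2 ∧ F S.1 < F S.2},
    (F S.1.2 - F S.1.1) / F (S.1.2 \ S.1.1)

/-- The squared Euclidean norm of a vector. -/
def sqNorm {m : ℕ} (v : Fin m → ℝ) : ℝ := ‖WithLp.toLp 2 v‖ ^ 2

/-- `Q = (1/n) Xᵀ X`. -/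
def gram {n d : ℕ} (X : Matrix (Fin n) (Fin d) ℝ) : Matrix (Fin d) (Fin d) ℝ :=
  (1 / (n : ℝ)) • (Xᵀ * X)

/-- The regularized least-squares cost `(1/(2n)) ‖y - X w‖₂² + lam Ω_p(w)`. -/
def cost {n d : ℕ} (p : ℝ≥0∞) (F : Finset (Fin d) → ℝ) (X : Matrix (Fin n) (Fin d) ℝ)
    (lam : ℝ) (y : Fin n → ℝ) (w : Fin d → ℝ) : ℝ :=
  1 / (2 * (n : ℝ)) * sqNorm (y - X *ᵥ w) + lam * omega p F w

/-- The `Ω_J`-restricted eigenvalue condition with constant `κ`. -/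
def RestrictedEigenvalue {n d : ℕ} (p : ℝ≥0∞) (F : Finset (Fin d) → ℝ)
    (X : Matrix (Fin n) (Fin d) ℝ) (J : Finset (Fin d)) (κ : ℝ) : Prop :=
  ∀ Δ : Fin d → ℝ, omegaContr p F J Δ ≤ 3 * omegaRestr p F J Δ →
    κ * omegaRestr p F J Δ ^ 2 ≤ Δ ⬝ᵥ (gram X *ᵥ Δ)

end StructuredSparsity

end

/-! The condition `dualOmega p G s ≤ 1` says that the vector `|s i| ^ q` satisfies the linear
constraints of the polyhedron of `G`. Submodularity therefore lets dual-feasible vectors for the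
restriction and the contraction at `J` be glued into one for `F`, so `Ω_J + Ω^J ≤ Ω`
(`omegaRestr_add_omegaContr_le`). Conversely `ρ F ≤ F^J` on nonempty subsets of `Jᶜ`, which gives `Ω
≤ Ω_J + ρ⁻¹ Ω^J` (`omega_le_omegaRestr_add`).

With these two bounds the Lasso argument applies (`error_bounds`). Let `a` and `b` be the `Ω_J` and
`Ω^J` parts of the error. If the noise has dual norm at most `λρ/2`, optimality gives `‖XΔ‖²/n ≤
λ(3a - b)`. Hence `b ≤ 3a`, the eigenvalue condition applies, and `κa² ≤ 3λa`. The probability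
enters only through the law of `Xᵀε/√n`, which is `N(0, Q)`. -/

namespace StructuredSparsity

/-! ### The norm and its dual for a positive set-function. -/

section GeneralNorm

variable {V : Type*} {p : ℝ≥0∞} {G : Finset V → ℝ}

lemma one_le_conjExp (hp : 1 < p) : 1 ≤ conjExp p := by
  -- Finiteness is needed because `toReal` sends `⊤` to `0`; this is where `p = 1` is excluded.
  have htop : p.conjExponent ≠ ⊤ := by
    simp [ENNReal.conjExponent, tsub_eq_zero_iff_le, hp]
  have h1 : (1 : ℝ≥0∞) ≤ p.conjExponent := by simp [ENNReal.conjExponent]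
  simpa [conjExp] using ENNReal.toReal_mono htop h1

lemma lqNormOn_le_mul_iff {q : ℝ} (hq : 0 < q) (A : Finset V) (s : V → ℝ) {g c : ℝ}
    (hg : 0 ≤ g) (hc : 0 ≤ c) :
    lqNormOn q A s ≤ c * g ^ (1 / q) ↔ ∑ i ∈ A, |s i| ^ q ≤ c ^ q * g := by
  have h : c * g ^ (1 / q) = (c ^ q * g) ^ (1 / q) := by
    rw [Real.mul_rpow (Real.rpow_nonneg hc _) hg, ← Real.rpow_mul hc, mul_one_div_cancel hq.ne',
      Real.rpow_one]
  rw [h, lqNormOn]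
  exact Real.rpow_le_rpow_iff (Finset.sum_nonneg fun i _ => Real.rpow_nonneg (abs_nonneg _) _)
    (mul_nonneg (Real.rpow_nonneg hc _) hg) (one_div_pos.mpr hq)

/-- Raising to the power `q` makes the constraints linear in `|s i| ^ q`. The condition `0 ≤ c` also
covers empty `V`, where the supremum takes the default value `0`; this occurs when `J` or `Jᶜ` is
empty. -/
lemma dualOmega_le_iff [Fintype V] (hp : 1 < p) (hG : ∀ A : Finset V, A.Nonempty → 0 < G A)
    (s : V → ℝ) {c : ℝ} (hc : 0 ≤ c) :
    dualOmega p G s ≤ c ↔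
      ∀ A : Finset V, A.Nonempty → ∑ i ∈ A, |s i| ^ conjExp p ≤ c ^ conjExp p * G A := by
  have hq : 0 < conjExp p := one_pos.trans_le (one_le_conjExp hp)
  have key (A : Finset V) (hA : A.Nonempty) :
      lqNormOn (conjExp p) A s / G A ^ (1 / conjExp p) ≤ c ↔
        ∑ i ∈ A, |s i| ^ conjExp p ≤ c ^ conjExp p * G A := by
    rw [div_le_iff₀ (Real.rpow_pos_of_pos (hG A hA) _),
      lqNormOn_le_mul_iff hq A s (hG A hA).le hc]
  constructor
  · intro h A hA
    refine (key A hA).1 (le_trans ?_ h)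
    exact le_ciSup (f := fun A : {A : Finset V // A.Nonempty} =>
      lqNormOn (conjExp p) A.1 s / G A.1 ^ (1 / conjExp p)) (Set.finite_range _).bddAbove ⟨A, hA⟩
  · intro h
    exact Real.iSup_le (fun A => (key A.1 A.2).2 (h A.1 A.2)) hc

lemma dualOmega_le_one_iff [Fintype V] (hp : 1 < p)
    (hG : ∀ A : Finset V, A.Nonempty → 0 < G A) (s : V → ℝ) :
    dualOmega p G s ≤ 1 ↔
      ∀ A : Finset V, A.Nonempty → ∑ i ∈ A, |s i| ^ conjExp p ≤ G A := by
  simpa using dualOmega_le_iff hp hG s zero_le_one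

lemma dualOmega_zero_le_one [Fintype V] (hp : 1 < p)
    (hG : ∀ A : Finset V, A.Nonempty → 0 < G A) : dualOmega p G (0 : V → ℝ) ≤ 1 := by
  have hq : conjExp p ≠ 0 := (one_pos.trans_le (one_le_conjExp hp)).ne'
  refine (dualOmega_le_one_iff hp hG 0).2 fun A hA => ?_
  simpa [Real.zero_rpow hq] using (hG A hA).le

lemma dualOmega_neg (s : V → ℝ) : dualOmega p G (-s) = dualOmega p G s := by
  simp [dualOmega, lqNormOn]

variable [Fintype V]

lemma dualOmega_smul_le (hp : 1 < p) (hG : ∀ A : Finset V, A.Nonempty → 0 < G A) {s : V → ℝ}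
    {c m : ℝ} (hc : 0 ≤ c) (hm : 0 ≤ m) (hs : dualOmega p G s ≤ m) :
    dualOmega p G (c • s) ≤ c * m := by
  refine (dualOmega_le_iff hp hG _ (mul_nonneg hc hm)).2 fun A hA => ?_
  have h (i : V) : |(c • s) i| ^ conjExp p = c ^ conjExp p * |s i| ^ conjExp p := by
    rw [Pi.smul_apply, smul_eq_mul, abs_mul, abs_of_nonneg hc, Real.mul_rpow hc (abs_nonneg _)]
  simp_rw [h, ← Finset.mul_sum]
  rw [Real.mul_rpow hc hm, mul_assoc]
  exact mul_le_mul_of_nonneg_left ((dualOmega_le_iff hp hG s hm).1 hs A hA)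
    (Real.rpow_nonneg hc _)

lemma dotProduct_le_omega (hp : 1 < p) (hG : ∀ A : Finset V, A.Nonempty → 0 < G A)
    {s : V → ℝ} (hs : dualOmega p G s ≤ 1) (w : V → ℝ) : s ⬝ᵥ w ≤ omega p G w := by
  have hq : 0 < conjExp p := one_pos.trans_le (one_le_conjExp hp)
  have hbdd : BddAbove (Set.range fun s : {s : V → ℝ // dualOmega p G s ≤ 1} => s.1 ⬝ᵥ w) := by
    -- The singleton constraints alone confine `s` to a box.
    refine ⟨∑ i, G {i} ^ (conjExp p)⁻¹ * |w i|, ?_⟩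
    rintro _ ⟨⟨s, hs⟩, rfl⟩
    refine Finset.sum_le_sum fun i _ => ?_
    have hi := (dualOmega_le_one_iff hp hG s).1 hs {i} (Finset.singleton_nonempty i)
    rw [Finset.sum_singleton] at hi
    have hsi : |s i| ≤ G {i} ^ (conjExp p)⁻¹ :=
      (Real.le_rpow_inv_iff_of_pos (abs_nonneg _) (hG _ (Finset.singleton_nonempty i)).le hq).2 hi
    calc s i * w i ≤ |s i| * |w i| := (le_abs_self _).trans (abs_mul _ _).le
      _ ≤ _ := mul_le_mul_of_nonneg_right hsi (abs_nonneg _)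
  exact le_ciSup hbdd ⟨s, hs⟩

lemma omega_le (hp : 1 < p) (hG : ∀ A : Finset V, A.Nonempty → 0 < G A) {w : V → ℝ} {c : ℝ}
    (h : ∀ s : V → ℝ, dualOmega p G s ≤ 1 → s ⬝ᵥ w ≤ c) : omega p G w ≤ c := by
  have : Nonempty {s : V → ℝ // dualOmega p G s ≤ 1} := ⟨0, dualOmega_zero_le_one hp hG⟩
  exact ciSup_le fun s => h s.1 s.2

lemma omega_nonneg (hp : 1 < p) (hG : ∀ A : Finset V, A.Nonempty → 0 < G A) (w : V → ℝ) :
    0 ≤ omega p G w := by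
  simpa using dotProduct_le_omega hp hG (dualOmega_zero_le_one hp hG) w

lemma omega_add_le (hp : 1 < p) (hG : ∀ A : Finset V, A.Nonempty → 0 < G A) (v w : V → ℝ) :
    omega p G (v + w) ≤ omega p G v + omega p G w :=
  omega_le hp hG fun s hs => by
    rw [dotProduct_add]
    exact add_le_add (dotProduct_le_omega hp hG hs v) (dotProduct_le_omega hp hG hs w)

lemma omega_neg (hp : 1 < p) (hG : ∀ A : Finset V, A.Nonempty → 0 < G A) (w : V → ℝ) :
    omega p G (-w) = omega p G w := by
  have key (w : V → ℝ) : omega p G (-w) ≤ omega p G w :=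
    omega_le hp hG fun s hs => by
      have := dotProduct_le_omega hp hG (s := -s) (by rwa [dualOmega_neg]) w
      simpa using this
  refine le_antisymm (key w) ?_
  simpa using key (-w)

lemma omega_zero (hp : 1 < p) (hG : ∀ A : Finset V, A.Nonempty → 0 < G A) :
    omega p G (0 : V → ℝ) = 0 :=
  le_antisymm (omega_le hp hG fun s _ => by simp) (omega_nonneg hp hG 0)

/-- The generalized Hölder inequality between a norm and its dual norm. -/
lemma dotProduct_le_mul_omega (hp : 1 < p) (hG : ∀ A : Finset V, A.Nonempty → 0 < G A)
    {s : V → ℝ} {c : ℝ} (hc : 0 < c) (hs : dualOmega p G s ≤ c) (w : V → ℝ) :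
    s ⬝ᵥ w ≤ c * omega p G w := by
  have h1 : dualOmega p G (c⁻¹ • s) ≤ 1 := by
    simpa [hc.ne'] using dualOmega_smul_le hp hG (inv_pos.2 hc).le hc.le hs
  have h2 := dotProduct_le_omega hp hG h1 w
  rw [smul_dotProduct, smul_eq_mul, inv_mul_le_iff₀ hc] at h2
  exact h2

end GeneralNorm

/-! ### Restriction, contraction and the two-sided decomposition of the norm. -/

section Decomposition

variable {V : Type*} [DecidableEq V] {p : ℝ≥0∞} {F : Finset V → ℝ} {J : Finset V}

lemma IsPolymatroidFunction.pos (hF : IsPolymatroidFunction F) (A : Finset V)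
    (hA : A.Nonempty) : 0 < F A := by
  obtain ⟨k, hk⟩ := hA
  exact (hF.singleton_pos k).trans_le (hF.mono _ _ (by simpa using hk))

lemma restriction_pos (hF : IsPolymatroidFunction F) (J : Finset V)
    (A : Finset {i // i ∈ J}) (hA : A.Nonempty) : 0 < restriction F J A :=
  hF.pos _ (by simpa using hA)

lemma IsStable.lt_union (hJ : IsStable F J) {A : Finset {i // i ∉ J}} (hA : A.Nonempty) :
    F J < F (A.map (Function.Embedding.subtype _) ∪ J) := by
  obtain ⟨k, hk⟩ := hA
  refine hJ _ (Finset.ssubset_iff_subset_ne.2 ⟨Finset.subset_union_right, fun h => k.2 ?_⟩)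
  exact h.symm.subset (Finset.mem_union_left _ (Finset.mem_map_of_mem _ hk))

/-- Stability of `J` serves exactly to make the general norm lemmas available for `F^J`. -/
lemma contraction_pos (hJ : IsStable F J) (A : Finset {i // i ∉ J}) (hA : A.Nonempty) :
    0 < contraction F J A :=
  sub_pos.2 (hJ.lt_union hA)

lemma map_sdiff_left (A : Finset {i // i ∉ J}) :
    (A.map (Function.Embedding.subtype _) ∪ J) \ J = A.map (Function.Embedding.subtype _) := by
  rw [Finset.union_sdiff_right, Finset.sdiff_eq_self_iff_disjoint, Finset.disjoint_left]
  rintro _ hi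
  obtain ⟨k, -, rfl⟩ := Finset.mem_map.1 hi
  exact k.2

lemma map_subtype_mem (A J : Finset V) :
    (A.subtype (· ∈ J)).map (Function.Embedding.subtype _) = A ∩ J := by
  rw [Finset.subtype_map, Finset.filter_mem_eq_inter]

lemma map_subtype_notMem_union (A J : Finset V) :
    (A.subtype (· ∉ J)).map (Function.Embedding.subtype _) ∪ J = A ∪ J := by
  rw [Finset.subtype_map]
  ext i
  simp only [Finset.mem_union, Finset.mem_filter]
  tauto

lemma sum_subtype_add_sum_subtype (A J : Finset V) (f : V → ℝ) :
    ∑ i ∈ A.subtype (· ∈ J), f i + ∑ i ∈ A.subtype (· ∉ J), f i = ∑ i ∈ A, f i := by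
  rw [Finset.sum_subtype_eq_sum_filter, Finset.sum_subtype_eq_sum_filter,
    Finset.sum_filter_add_sum_filter_not]

variable [Fintype V]

lemma rho_le {A B : Finset V} (hAB : A ⊆ B) (hlt : F A < F B) :
    rho F ≤ (F B - F A) / F (B \ A) := by
  exact ciInf_le (f := fun S : {S : Finset V × Finset V // S.1 ⊆ S.2 ∧ F S.1 < F S.2} =>
    (F S.1.2 - F S.1.1) / F (S.1.2 \ S.1.1)) (Set.finite_range _).bddBelow ⟨(A, B), hAB, hlt⟩

lemma rho_pos [Nonempty V] (hF : IsPolymatroidFunction F) : 0 < rho F := by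
  let k : V := Classical.arbitrary V
  -- Over an empty family the infimum would default to `0`; here it is an attained minimum of
  -- positive ratios.
  have : Nonempty {S : Finset V × Finset V // S.1 ⊆ S.2 ∧ F S.1 < F S.2} :=
    ⟨(∅, {k}), by simp, by simpa [hF.empty] using hF.singleton_pos k⟩
  obtain ⟨S, hS⟩ := exists_eq_ciInf_of_finite
    (f := fun S : {S : Finset V × Finset V // S.1 ⊆ S.2 ∧ F S.1 < F S.2} =>
      (F S.1.2 - F S.1.1) / F (S.1.2 \ S.1.1))
  rw [rho, ← hS]
  refine div_pos (sub_pos.2 S.2.2) (hF.pos _ ?_)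
  rw [Finset.sdiff_nonempty]
  exact fun h => S.2.2.not_ge (hF.mono _ _ h)

lemma rho_le_one [Nonempty V] (hF : IsPolymatroidFunction F) : rho F ≤ 1 := by
  let k : V := Classical.arbitrary V
  have h := rho_le (F := F) (Finset.empty_subset {k}) (by simpa [hF.empty] using hF.singleton_pos k)
  rwa [Finset.sdiff_empty, hF.empty, sub_zero, div_self (hF.singleton_pos k).ne'] at h

lemma rho_mul_le_contraction (hF : IsPolymatroidFunction F) (hJ : IsStable F J)
    (A : Finset {i // i ∉ J}) (hA : A.Nonempty) :
    rho F * F (A.map (Function.Embedding.subtype _)) ≤ contraction F J A := by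
  have h := rho_le Finset.subset_union_right (hJ.lt_union hA)
  rw [map_sdiff_left] at h
  exact (le_div_iff₀ (hF.pos _ (by simpa using hA))).1 h

lemma dotProduct_eq_add (J : Finset V) (s w : V → ℝ) :
    s ⬝ᵥ w = (fun i : {i // i ∈ J} => s i) ⬝ᵥ (fun i => w i.1) +
      (fun i : {i // i ∉ J} => s i) ⬝ᵥ (fun i => w i.1) := by
  simp only [dotProduct]
  rw [Finset.sum_coe_sort J fun i => s i * w i,
    ← Finset.sum_subtype Jᶜ (fun i => Finset.mem_compl) fun i => s i * w i,
    Finset.sum_add_sum_compl]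

/-- The lower bound `Ω_J(w_J) + Ω^J(w_{Jᶜ}) ≤ Ω(w)`. -/
lemma omegaRestr_add_omegaContr_le (hp : 1 < p) (hF : IsPolymatroidFunction F)
    (hJ : IsStable F J) (w : V → ℝ) :
    omegaRestr p F J w + omegaContr p F J w ≤ omega p F w := by
  rw [← le_sub_iff_add_le]
  refine omega_le hp (restriction_pos hF J) fun s hs => ?_
  rw [le_sub_comm]
  refine omega_le hp (contraction_pos hJ) fun t ht => ?_
  rw [le_sub_iff_add_le']
  -- Gluing works since the two constraints add up to `F (A ∩ J) + F (A ∪ J) - F J`, at most `F A`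
  -- by submodularity.
  let u : V → ℝ := fun i => if h : i ∈ J then s ⟨i, h⟩ else t ⟨i, h⟩
  have hus : (fun i : {i // i ∈ J} => u i) = s := by ext i; simp [u]
  have hut : (fun i : {i // i ∉ J} => u i) = t := by ext i; simp [u, i.2]
  have hu : dualOmega p F u ≤ 1 := by
    refine (dualOmega_le_one_iff hp hF.pos u).2 fun A hA => ?_
    have h1 : ∑ i ∈ A.subtype (· ∈ J), |u i| ^ conjExp p ≤ F (A ∩ J) := by
      rcases (A.subtype (· ∈ J)).eq_empty_or_nonempty with h | h
      · rw [h, Finset.sum_empty, ← hF.empty]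
        exact hF.mono _ _ (Finset.empty_subset _)
      · have := (dualOmega_le_one_iff hp (restriction_pos hF J) s).1 hs _ h
        rw [restriction, map_subtype_mem, ← hus] at this
        exact this
    have h2 : ∑ i ∈ A.subtype (· ∉ J), |u i| ^ conjExp p ≤ F (A ∪ J) - F J := by
      rcases (A.subtype (· ∉ J)).eq_empty_or_nonempty with h | h
      · rw [h, Finset.sum_empty, sub_nonneg]
        exact hF.mono _ _ Finset.subset_union_right
      · have := (dualOmega_le_one_iff hp (contraction_pos hJ) t).1 ht _ h
        rw [contraction, map_subtype_notMem_union, ← hut] at this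
        exact this
    rw [← sum_subtype_add_sum_subtype A J]
    linarith [hF.submodular A J]
  have := dotProduct_le_omega hp hF.pos hu w
  rwa [dotProduct_eq_add J, hus, hut] at this

/-- The upper bound `Ω(w) ≤ Ω_J(w_J) + ρ⁻¹ Ω^J(w_{Jᶜ})`. -/
lemma omega_le_omegaRestr_add [Nonempty V] (hp : 1 < p) (hF : IsPolymatroidFunction F)
    (hJ : IsStable F J) (w : V → ℝ) :
    omega p F w ≤ omegaRestr p F J w + (rho F)⁻¹ * omegaContr p F J w := by
  have hρ := rho_pos hF
  have hq := one_le_conjExp hp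
  refine omega_le hp hF.pos fun s hs => ?_
  rw [dualOmega_le_one_iff hp hF.pos] at hs
  rw [dotProduct_eq_add J]
  refine add_le_add (dotProduct_le_omega hp (restriction_pos hF J) ?_ _)
    (dotProduct_le_mul_omega hp (contraction_pos hJ) (inv_pos.2 hρ) ?_ _)
  · refine (dualOmega_le_one_iff hp (restriction_pos hF J) _).2 fun A hA => ?_
    have := hs _ ((Finset.map_nonempty (f := Function.Embedding.subtype _)).2 hA)
    rwa [Finset.sum_map] at this
  · refine (dualOmega_le_iff hp (contraction_pos hJ) _ (inv_pos.2 hρ).le).2 fun A hA => ?_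
    have h1 := hs _ ((Finset.map_nonempty (f := Function.Embedding.subtype _)).2 hA)
    rw [Finset.sum_map] at h1
    have h2 := rho_mul_le_contraction hF hJ A hA
    -- The comparison of set-functions yields dual radius `ρ^(-1/q)`; since `ρ ≤ 1 ≤ q`, it is
    -- relaxed to `ρ⁻¹`.
    have h3 : (rho F)⁻¹ ≤ (rho F)⁻¹ ^ conjExp p := by
      simpa using Real.rpow_le_rpow_of_exponent_le (one_le_inv₀ hρ |>.2 (rho_le_one hF)) hq
    calc _ ≤ F (A.map (Function.Embedding.subtype _)) := h1
      _ ≤ (rho F)⁻¹ * contraction F J A := (le_inv_mul_iff₀ hρ).2 h2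
      _ ≤ _ := mul_le_mul_of_nonneg_right h3 (contraction_pos hJ A hA).le

/-- `Ω(w) ≤ Ω_J(w_J)` for `w` supported in `J`. -/
lemma omega_le_omegaRestr [Nonempty V] (hp : 1 < p) (hF : IsPolymatroidFunction F)
    (hJ : IsStable F J) {w : V → ℝ} (hw : supp w ⊆ J) : omega p F w ≤ omegaRestr p F J w := by
  have h0 : (fun i : {i // i ∉ J} => w i) = 0 := by
    ext i
    by_contra h
    exact i.2 (hw (by simpa [supp] using h))
  have := omega_le_omegaRestr_add hp hF hJ w
  rwa [omegaContr, h0, omega_zero hp (contraction_pos hJ), mul_zero, add_zero] at this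

end Decomposition

/-! ### Deterministic error bounds for regularized least squares. -/

section LeastSquares

variable {n d : ℕ}

lemma sqNorm_eq_dotProduct {m : ℕ} (v : Fin m → ℝ) : sqNorm v = v ⬝ᵥ v := by
  rw [sqNorm, EuclideanSpace.real_norm_sq_eq]
  simp [dotProduct, sq]

lemma sqNorm_sub {m : ℕ} (u v : Fin m → ℝ) :
    sqNorm (u - v) = sqNorm u - 2 * (u ⬝ᵥ v) + sqNorm v := by
  simp only [sqNorm_eq_dotProduct, sub_dotProduct, dotProduct_sub, dotProduct_comm v u]
  ring

lemma dotProduct_gram_mulVec (X : Matrix (Fin n) (Fin d) ℝ) (v : Fin d → ℝ) :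
    v ⬝ᵥ (gram X *ᵥ v) = 1 / (n : ℝ) * sqNorm (X *ᵥ v) := by
  rw [gram, Matrix.smul_mulVec, dotProduct_smul, smul_eq_mul, ← Matrix.mulVec_mulVec,
    Matrix.dotProduct_mulVec, Matrix.vecMul_transpose, sqNorm_eq_dotProduct]

/-- The basic inequality satisfied by a minimizer of the regularized least-squares cost. -/
lemma basic_inequality {p : ℝ≥0∞} {F : Finset (Fin d) → ℝ} {X : Matrix (Fin n) (Fin d) ℝ}
    {lam : ℝ} {w₀ w : Fin d → ℝ} {r : Fin n → ℝ}
    (h : cost p F X lam (X *ᵥ w₀ + r) w ≤ cost p F X lam (X *ᵥ w₀ + r) w₀) :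
    1 / (2 * (n : ℝ)) * sqNorm (X *ᵥ (w - w₀)) ≤
      ((1 / (n : ℝ)) • (Xᵀ *ᵥ r)) ⬝ᵥ (w - w₀) + lam * (omega p F w₀ - omega p F w) := by
  have h1 : X *ᵥ w₀ + r - X *ᵥ w = r - X *ᵥ (w - w₀) := by
    rw [Matrix.mulVec_sub]; abel
  have h2 : (Xᵀ *ᵥ r) ⬝ᵥ (w - w₀) = r ⬝ᵥ (X *ᵥ (w - w₀)) := by
    rw [Matrix.mulVec_transpose, ← Matrix.dotProduct_mulVec]
  rw [cost, cost, h1, add_sub_cancel_left, sqNorm_sub] at h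
  rw [smul_dotProduct, h2, smul_eq_mul]
  have h3 : 1 / (2 * (n : ℝ)) = 1 / (n : ℝ) / 2 := by ring
  rw [h3] at h ⊢
  linarith

/-- Both error bounds, for noise `r` with `Ω^*(Xᵀ r / n) ≤ λ ρ / 2`. -/
lemma error_bounds (hd : 0 < d) {p : ℝ≥0∞} (hp : 1 < p) {F : Finset (Fin d) → ℝ}
    (hF : IsPolymatroidFunction F) {X : Matrix (Fin n) (Fin d) ℝ} {w₀ w : Fin d → ℝ}
    {lam κ : ℝ} (hlam : 0 < lam) (hκ : 0 < κ) {J : Finset (Fin d)} (hJ : IsStable F J)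
    (hw₀ : supp w₀ ⊆ J) (hRE : RestrictedEigenvalue p F X J κ) {r : Fin n → ℝ}
    (hr : dualOmega p F ((1 / (n : ℝ)) • (Xᵀ *ᵥ r)) ≤ lam * rho F / 2)
    (h : cost p F X lam (X *ᵥ w₀ + r) w ≤ cost p F X lam (X *ᵥ w₀ + r) w₀) :
    omega p F (w - w₀) ≤ 24 ^ 2 * lam / (κ * rho F ^ 2) ∧
      1 / (n : ℝ) * sqNorm (X *ᵥ w - X *ᵥ w₀) ≤ 36 * lam ^ 2 / (κ * rho F ^ 2) := by
  have : Nonempty (Fin d) := ⟨⟨0, hd⟩⟩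
  have hρ := rho_pos hF
  have hρ1 := rho_le_one hF
  have hbasic := basic_inequality h
  rw [← Matrix.mulVec_sub]
  set v := w - w₀ with hv
  set a := omegaRestr p F J v with ha
  set b := omegaContr p F J v with hb
  have ha0 : 0 ≤ a := omega_nonneg hp (restriction_pos hF J) _
  have hb0 : 0 ≤ b := omega_nonneg hp (contraction_pos hJ) _
  have hup : omega p F v ≤ a + (rho F)⁻¹ * b := omega_le_omegaRestr_add hp hF hJ v
  have hnoise := dotProduct_le_mul_omega hp hF.pos (by positivity) hr v
  -- The factor `ρ` in the noise level cancels the `ρ⁻¹` of the upper decomposition bound.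
  have hnoise' : lam * rho F / 2 * omega p F v ≤ lam / 2 * (a + b) := by
    calc lam * rho F / 2 * omega p F v ≤ lam * rho F / 2 * (a + (rho F)⁻¹ * b) := by gcongr
      _ = lam / 2 * (rho F * a + b) := by field_simp
      _ ≤ lam / 2 * (1 * a + b) := by gcongr
      _ = lam / 2 * (a + b) := by rw [one_mul]
  -- Triangle inequality on `J`; off `J` the vector `w₀` vanishes, so `w` and `v` agree there.
  have hlow : omegaRestr p F J w₀ - a + b ≤ omega p F w := by
    have h1 := omegaRestr_add_omegaContr_le hp hF hJ w
    have h2 : omegaRestr p F J w₀ ≤ omegaRestr p F J w + a := by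
      have := omega_add_le hp (restriction_pos hF J) (fun i => w i.1) (-fun i => v i.1)
      rw [omega_neg hp (restriction_pos hF J)] at this
      refine le_of_eq_of_le (congrArg (omega p (restriction F J)) ?_) this
      ext i
      simp [hv]
    have h3 : omegaContr p F J w = b := by
      refine congrArg (omega p (contraction F J)) ?_
      ext i
      have : w₀ i = 0 := by
        by_contra h
        exact i.2 (hw₀ (by simpa [supp] using h))
      simp [hv, this]
    linarith
  have hw₀' := omega_le_omegaRestr hp hF hJ hw₀
  have hdiff : lam * (omega p F w₀ - omega p F w) ≤ lam * (a - b) :=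
    mul_le_mul_of_nonneg_left (by linarith) hlam.le
  -- Doubling `λ(a + b)/2 + λ(a - b)` gives `λ(3a - b)`, hence the constant `3` of the cone.
  have hmain : 1 / (n : ℝ) * sqNorm (X *ᵥ v) ≤ lam * (3 * a - b) := by
    have h3 : 1 / (2 * (n : ℝ)) = 1 / (n : ℝ) / 2 := by ring
    rw [h3] at hbasic
    linarith
  have hcone : b ≤ 3 * a := by
    have h0 : 0 ≤ 1 / (n : ℝ) * sqNorm (X *ᵥ v) := mul_nonneg (by positivity) (sq_nonneg _)
    linarith [nonneg_of_mul_nonneg_right (h0.trans hmain) hlam]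
  have hre := hRE v hcone
  rw [dotProduct_gram_mulVec, ← ha] at hre
  have hmain' : 1 / (n : ℝ) * sqNorm (X *ᵥ v) ≤ 3 * lam * a := by
    nlinarith [mul_nonneg hlam.le hb0]
  have hale : a ≤ 3 * lam / κ := by
    rw [le_div_iff₀ hκ]
    -- For `a > 0`, one factor `a` is cancelled from `κa² ≤ 3λa`.
    rcases ha0.eq_or_lt with h0 | h0
    · rw [← h0]; linarith
    · refine le_of_mul_le_mul_right ?_ h0
      linarith
  have hsq : rho F ^ 2 ≤ 1 := pow_le_one₀ hρ.le hρ1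
  -- The argument gives `12λ/(κρ)` and `9λ²/κ`; `ρ ≤ 1` relaxes both to the stated constants.
  constructor
  · calc omega p F v ≤ a + (rho F)⁻¹ * b := hup
      _ ≤ (rho F)⁻¹ * a + (rho F)⁻¹ * (3 * a) := by
        gcongr
        exact le_mul_of_one_le_left ha0 ((one_le_inv₀ hρ).2 hρ1)
      _ = (rho F)⁻¹ * (4 * a) := by ring
      _ ≤ (rho F)⁻¹ * (4 * (3 * lam / κ)) := by gcongr
      _ = 12 * lam * rho F / (κ * rho F ^ 2) := by field_simp; ring
      _ ≤ 24 ^ 2 * lam / (κ * rho F ^ 2) := by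
        refine div_le_div_of_nonneg_right ?_ (by positivity)
        nlinarith
  · calc 1 / (n : ℝ) * sqNorm (X *ᵥ v) ≤ 3 * lam * a := hmain'
      _ ≤ 3 * lam * (3 * lam / κ) := by gcongr
      _ = 9 * lam ^ 2 * rho F ^ 2 / (κ * rho F ^ 2) := by field_simp; ring
      _ ≤ 36 * lam ^ 2 / (κ * rho F ^ 2) := by
        refine div_le_div_of_nonneg_right ?_ (by positivity)
        nlinarith [sq_nonneg lam]

end LeastSquares

/-! ### The law of the rescaled noise. -/

section Gaussian

variable {n d : ℕ}

lemma measurable_dualOmega {V : Type*} [Fintype V] (p : ℝ≥0∞) (G : Finset V → ℝ) :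
    Measurable (dualOmega p G) := by
  unfold dualOmega lqNormOn
  refine Measurable.iSup fun A => ?_
  fun_prop

lemma posSemidef_gram (X : Matrix (Fin n) (Fin d) ℝ) : (gram X).PosSemidef := by
  have h := Matrix.posSemidef_conjTranspose_mul_self X
  rw [Matrix.conjTranspose_eq_transpose_of_trivial] at h
  exact h.smul (by positivity)

/-- The image of a standard normal vector `ε` under `ε ↦ Xᵀ ε / √n` is a centred normal vector
with covariance matrix `Q`. -/
lemma map_stdGaussian_eq_multivariateGaussian (X : Matrix (Fin n) (Fin d) ℝ) :
    (stdGaussian (EuclideanSpace ℝ (Fin n))).map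
        ((1 / √(n : ℝ)) • (Matrix.toEuclideanLin Xᵀ).toContinuousLinearMap) =
      multivariateGaussian 0 (gram X) := by
  apply Measure.ext_of_charFun
  ext t
  rw [charFun_multivariateGaussian (posSemidef_gram X)]
  set L : EuclideanSpace ℝ (Fin n) →L[ℝ] EuclideanSpace ℝ (Fin d) :=
    (1 / √(n : ℝ)) • (Matrix.toEuclideanLin Xᵀ).toContinuousLinearMap with hL
  -- The characteristic function of the image at `t` is that of `ε` at the adjoint vector `Xt/√n`,
  -- whose squared norm is `tᵀQt`.
  have hadj : L.adjoint t = WithLp.toLp 2 ((1 / √(n : ℝ)) • (X *ᵥ t.ofLp)) := by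
    refine ext_inner_right ℝ fun v => ?_
    rw [ContinuousLinearMap.adjoint_inner_left]
    simp [hL, EuclideanSpace.inner_eq_star_dotProduct, Matrix.toLpLin_apply, inner_smul_right,
      Matrix.mulVec_transpose, ← Matrix.dotProduct_mulVec]
  rw [charFun_apply, integral_map L.continuous.aemeasurable (by fun_prop)]
  simp_rw [← ContinuousLinearMap.adjoint_inner_right]
  rw [← charFun_apply, charFun_stdGaussian, hadj]
  have : ‖WithLp.toLp 2 ((1 / √(n : ℝ)) • (X *ᵥ t.ofLp))‖ ^ 2 = t.ofLp ⬝ᵥ gram X *ᵥ t.ofLp := by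
    rw [dotProduct_gram_mulVec, WithLp.toLp_smul, norm_smul, mul_pow, sqNorm]
    simp
  norm_cast
  rw [this]
  simp [neg_div]

end Gaussian

end StructuredSparsity

theorem mainTheorem11 {n d : ℕ} (hn : 0 < n) (hd : 0 < d)
    (p : ℝ≥0∞) (hp : 1 < p)
    (F : Finset (Fin d) → ℝ) (hF : StructuredSparsity.IsPolymatroidFunction F)
    (X : Matrix (Fin n) (Fin d) ℝ) (wstar : Fin d → ℝ)
    (σ lam κ : ℝ) (hσ : 0 < σ) (hlam : 0 < lam) (hκ : 0 < κ)
    (J : Finset (Fin d))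
    (hJ : IsLeast {A : Finset (Fin d) |
      StructuredSparsity.IsStable F A ∧ StructuredSparsity.supp wstar ⊆ A} J)
    (hRE : StructuredSparsity.RestrictedEigenvalue p F X J κ)
    {Ω : Type*} [MeasurableSpace Ω] (P : Measure Ω) [IsProbabilityMeasure P]
    (ε : Ω → EuclideanSpace ℝ (Fin n))
    (hε : HasLaw ε (stdGaussian (EuclideanSpace ℝ (Fin n))) P) :
    ∃ E : Set Ω, MeasurableSet E ∧
      1 - (multivariateGaussian 0 (StructuredSparsity.gram X)).real
          {z : EuclideanSpace ℝ (Fin d) |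
            lam * StructuredSparsity.rho F * √(n : ℝ) / (2 * σ)
              < StructuredSparsity.dualOmega p F z} ≤ P.real E ∧
      ∀ ω ∈ E, ∀ what : Fin d → ℝ,
        IsMinOn (StructuredSparsity.cost p F X lam (X *ᵥ wstar + σ • (ε ω : Fin n → ℝ)))
          Set.univ what →
        StructuredSparsity.omega p F (what - wstar)
            ≤ 24 ^ 2 * lam / (κ * StructuredSparsity.rho F ^ 2) ∧
        1 / (n : ℝ) * StructuredSparsity.sqNorm (X *ᵥ what - X *ᵥ wstar)
            ≤ 36 * lam ^ 2 / (κ * StructuredSparsity.rho F ^ 2) := by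
  have hthr : 0 < lam * StructuredSparsity.rho F * √(n : ℝ) / (2 * σ) := by
    have : Nonempty (Fin d) := ⟨⟨0, hd⟩⟩
    have := StructuredSparsity.rho_pos hF
    positivity
  set c := lam * StructuredSparsity.rho F * √(n : ℝ) / (2 * σ) with hc
  have hn' : (0 : ℝ) < √(n : ℝ) := Real.sqrt_pos.2 (by exact_mod_cast hn)
  set L : EuclideanSpace ℝ (Fin n) →L[ℝ] EuclideanSpace ℝ (Fin d) :=
    (1 / √(n : ℝ)) • (Matrix.toEuclideanLin Xᵀ).toContinuousLinearMap with hL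
  set B : Set (EuclideanSpace ℝ (Fin d)) := {z | c < StructuredSparsity.dualOmega p F z} with hB
  have hBm : MeasurableSet B :=
    measurableSet_lt measurable_const
      ((StructuredSparsity.measurable_dualOmega p F).comp (by fun_prop))
  have hLm : Measurable L := L.continuous.measurable
  have hlaw : P.map (fun ω => L (ε ω)) = multivariateGaussian 0 (StructuredSparsity.gram X) := by
    rw [← StructuredSparsity.map_stdGaussian_eq_multivariateGaussian X, ← hε.map_eq,
      AEMeasurable.map_map_of_aemeasurable hLm.aemeasurable hε.aemeasurable]
    rfl
  have hLε : AEMeasurable (fun ω => L (ε ω)) P := hLm.comp_aemeasurable hε.aemeasurable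
  have hnull : NullMeasurableSet ((fun ω => L (ε ω)) ⁻¹' Bᶜ) P :=
    hLε.nullMeasurableSet_preimage hBm.compl
  -- As `ε` is only a.e. measurable, the good event is only null-measurable; a measurable subset of
  -- equal probability replaces it.
  obtain ⟨E, hEsub, hEm, hEae⟩ := hnull.exists_measurable_subset_ae_eq
  refine ⟨E, hEm, ?_, fun ω hω what hmin => ?_⟩
  · rw [measureReal_congr hEae, ← probReal_compl_eq_one_sub hBm, ← hlaw,
      map_measureReal_apply_of_aemeasurable hLε hBm.compl]
  · refine StructuredSparsity.error_bounds hd hp hF hlam hκ hJ.1.1 hJ.1.2 hRE ?_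
      (hmin (Set.mem_univ wstar))
    have hz : StructuredSparsity.dualOmega p F (L (ε ω)) ≤ c := not_lt.1 (hEsub hω)
    -- The scaling `σ/√n` turns the threshold `c` into the noise level `λρ/2` required by
    -- `error_bounds`.
    have heq : (1 / (n : ℝ)) • (Xᵀ *ᵥ (σ • (ε ω).ofLp)) = (σ / √(n : ℝ)) • (L (ε ω)).ofLp := by
      ext i
      simp [hL, Matrix.toLpLin_apply, Matrix.mulVec_smul]
      ring_nf
      rw [inv_pow, Real.sq_sqrt n.cast_nonneg]
      ring
    rw [heq]
    convert StructuredSparsity.dualOmega_smul_le hp hF.pos (div_pos hσ hn').le hthr.le hz using 1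
    rw [hc]
    field_simp
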